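/- Let $A$ be a (unital, associative, not necessarily commutative) ring, $I$ a two-sided ideal of $A$ and $B := A/I$. Write $\mathrm{Mod}\,A$, $\mathrm{Mod}\,B$ for the categories of left modules, and let $\iota : \mathrm{Mod}\,B \to \mathrm{Mod}\,A$ be the full embedding given by restriction of scalars along $A \to B$. For $\mathcal G = \mathrm{Mod}\,A$ or $\mathrm{Mod}\,B$ and complexes $V, W$ (unbounded in both directions) in $\mathcal G$, let $\mathrm{RHom}_{\mathcal G}(V, W)$ be the object of the derived category $D\mathbb Z$ of abelian groups represented by the total Hom complex $\mathrm{Hom}^\bullet_{\mathcal G}(V, J)$, where $W \to J$ is a K-injective resolution of $W$ in $\mathcal G$, that is, a quasi-isomorphism to a complex $J$ such that every morphism from an acyclic complex to $J$ is homotopic to zero. Suppose that there is a finite projective resolution $$0 \to P_n \to \cdots \to P_1 \to P_0 \to B \to 0$$ of $B$ by left $A$-modules such that $\mathrm{Hom}_A(P_j, V) = 0$ for all $B$-modules $V$ and all $j > 0$. Then the pair $(\mathrm{Mod}\,A, \mathrm{Mod}\,B)$ satisfies condition (R): $\mathrm{RHom}_{\mathrm{Mod}\,A}$ and $\mathrm{RHom}_{\mathrm{Mod}\,B}$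 are defined on all pairs of complexes (every complex has a K-injective resolution), and for all $V, W \in D(\mathrm{Mod}\,B)$ the objects $\mathrm{RHom}_{\mathrm{Mod}\,A}(\iota V, \iota W)$ and $\mathrm{RHom}_{\mathrm{Mod}\,B}(V, W)$ are canonically isomorphic in $D\mathbb Z$. Explicitly: if $W \to J_B$ is a K-injective resolution in $\mathrm{Mod}\,B$ and $\iota W \to J_A$ one in $\mathrm{Mod}\,A$, then there is a morphism of complexes $\varphi : \iota J_B \to J_A$ under $\iota W$ up to homotopy, and the morphism of $D\mathbb Z$ represented by $$\mathrm{Hom}^\bullet_B(V, J_B) \to \mathrm{Hom}^\bullet_A(\iota V, \iota J_B) \xrightarrow{\ \varphi_*\ } \mathrm{Hom}^\bullet_A(\iota V, J_A)$$ is an isomorphism which does not depend on the choice of such a $\varphi$. -/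

import Mathlib

open CategoryTheory

universe w v u u₁ u₂

namespace RHomComparison

section Resolution

variable {C : Type u} [Category.{v} C] [Abelian C]

/-- A K-injective resolution of an (unbounded) complex `W` : a quasi-isomorphism from `W`
to a K-injective complex. -/
structure KInjectiveResolution (W : CochainComplex C ℤ) where
  /-- the resolving complex -/
  complex : CochainComplex C ℤ
  /-- the augmentation -/
  ι : W ⟶ complex
  isKInjective : complex.IsKInjective
  quasiIso : QuasiIso ι

variable (C) in
/-- Every complex has a K-injective resolution; equivalently, `RHom` (computed by K-injective
resolutions of the second variable) is defined on the whole of `D(C)ᵒᵖ × D(C)`. -/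
def EnoughKInjectives : Prop :=
  ∀ W : CochainComplex C ℤ, Nonempty (KInjectiveResolution W)

/-- `RHom(V, W)`, as an object of the derived category of abelian groups: the total complex of
morphisms `Hom^•(V, I)`, where `W ⟶ I` is a K-injective resolution of `W`. -/
noncomputable def RHom [HasDerivedCategory.{w} AddCommGrpCat.{v}]
    (V : CochainComplex C ℤ) {W : CochainComplex C ℤ} (I : KInjectiveResolution W) :
    DerivedCategory AddCommGrpCat.{v} :=
  DerivedCategory.Q.obj (CochainComplex.HomComplex V I.complex)

/-- The morphism `Hom^•(V, K) ⟶ Hom^•(V, L)` given by composition with `φ : K ⟶ L`. -/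
noncomputable def homComplexPostcomp (V : CochainComplex C ℤ) {K L : CochainComplex C ℤ}
    (φ : K ⟶ L) :
    CochainComplex.HomComplex V K ⟶ CochainComplex.HomComplex V L where
  f n := AddCommGrpCat.ofHom
    { toFun := fun z => CochainComplex.HomComplex.Cochain.comp z
        (CochainComplex.HomComplex.Cochain.ofHom φ) (add_zero n)
      map_zero' := CochainComplex.HomComplex.Cochain.zero_comp _ _
      map_add' := fun _ _ => CochainComplex.HomComplex.Cochain.add_comp _ _ _ _ }
  comm' i j _ := by
    ext z
    exact CochainComplex.HomComplex.δ_comp_ofHom z φ j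

end Resolution

section Comparison

variable {C₁ : Type u₁} [Category.{v} C₁] [Abelian C₁]
  {C₂ : Type u₂} [Category.{v} C₂] [Abelian C₂]
  (F : C₂ ⥤ C₁) [F.Additive]

/-- The functor on complexes induced by the additive functor `F`. -/
noncomputable abbrev onComplexes : CochainComplex C₂ ℤ ⥤ CochainComplex C₁ ℤ :=
  F.mapHomologicalComplex (ComplexShape.up ℤ)

/-- The morphism `Hom^•(V, K) ⟶ Hom^•(F V, F K)` given by applying `F`
to the components of cochains. -/
noncomputable def homComplexMap (V K : CochainComplex C₂ ℤ) :
    CochainComplex.HomComplex V K ⟶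
      CochainComplex.HomComplex ((onComplexes F).obj V) ((onComplexes F).obj K) where
  f n := AddCommGrpCat.ofHom
    { toFun := fun z => CochainComplex.HomComplex.Cochain.map z F
      map_zero' := CochainComplex.HomComplex.Cochain.map_zero _ _ _ _
      map_add' := fun _ _ => CochainComplex.HomComplex.Cochain.map_add _ _ _ }
  comm' i j _ := by
    ext z
    exact CochainComplex.HomComplex.δ_map i j z F

variable {F} {W : CochainComplex C₂ ℤ}

/-- A morphism `φ : F I ⟶ J` between resolutions (`I` a resolution of `W`, `J` one of `F W`)
lifts the identity of `F W` if the triangle under `F W` commutes up to homotopy. -/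
def LiftsIdentity (I : KInjectiveResolution W)
    (J : KInjectiveResolution ((onComplexes F).obj W))
    (φ : (onComplexes F).obj I.complex ⟶ J.complex) : Prop :=
  Nonempty (Homotopy ((onComplexes F).map I.ι ≫ φ) J.ι)

/-- The morphism `RHom(V, W) ⟶ RHom(F V, F W)` attached to a morphism `φ : F I ⟶ J`
between the resolutions: the image in the derived category of abelian groups of
`Hom^•(V, I) ⟶ Hom^•(F V, F I) ⟶ Hom^•(F V, J)`. -/
noncomputable def comparison [HasDerivedCategory.{w} AddCommGrpCat.{v}]
    (V : CochainComplex C₂ ℤ) (I : KInjectiveResolution W)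
    (J : KInjectiveResolution ((onComplexes F).obj W))
    (φ : (onComplexes F).obj I.complex ⟶ J.complex) :
    RHom V I ⟶ RHom ((onComplexes F).obj V) J :=
  DerivedCategory.Q.map
    (homComplexMap F V I.complex ≫ homComplexPostcomp ((onComplexes F).obj V) φ)

variable (F) in
/-- Condition (R) for the pair `(C₁, C₂)`, the category `C₂` being regarded as a full subcategory
of `C₁` through the (fully faithful, exact) functor `F : C₂ ⥤ C₁` : the functors `RHom` of `C₁`
and of `C₂` are defined everywhere, and, for all complexes `V`, `W` in `C₂`, the objects
`RHom(V, W)` and `RHom(F V, F W)` are canonically isomorphic in the derived category of abelian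
groups. This means: however the resolutions `W ⟶ I` in `C₂` and `F W ⟶ J` in `C₁` are chosen,
the identity of `F W` lifts to a morphism `F I ⟶ J`, and all the lifts induce one and the same
morphism `RHom(V, W) ⟶ RHom(F V, F W)`, which is an isomorphism. -/
def ConditionR [HasDerivedCategory.{w} AddCommGrpCat.{v}] : Prop :=
  EnoughKInjectives C₁ ∧ EnoughKInjectives C₂ ∧
  ∀ (V W : CochainComplex C₂ ℤ) (I : KInjectiveResolution W)
    (J : KInjectiveResolution ((onComplexes F).obj W)),
    (∃ φ : (onComplexes F).obj I.complex ⟶ J.complex, LiftsIdentity I J φ) ∧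
    ∃ e : RHom V I ≅ RHom ((onComplexes F).obj V) J,
      ∀ φ : (onComplexes F).obj I.complex ⟶ J.complex,
        LiftsIdentity I J φ → comparison V I J φ = e.hom

end Comparison

end RHomComparison

/-! Restriction of scalars `F` is exact and has the right adjoint `G = Hom_A(B, -)`, so `G J_A` is
K-injective over `B`. By adjunction `Hom_A(F V, J_A) ≅ Hom_B(V, G J_A)`, and the comparison map
becomes postcomposition with the adjunct `J_B ⟶ G J_A` of `φ`. If the adjunct is a
quasi-isomorphism, it is a homotopy equivalence between K-injectives, and the comparison is an
isomorphism for every `V` (`isIso_comparison`).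

Up to shift, the cohomology of `G J_A` is `Hom(B, J_A[n])` in the homotopy category. K-injectivity
of `J_A` lets `B` be replaced by `P`; K-projectivity of `P` lets `J_A` be replaced by `F J_B`; and
`Hom_A(P, F J_B) = Hom_A(B, F J_B)` already on cochains, because maps from `P_j` to `B`-modules
vanish for `j > 0`. Since `F` is fully faithful, what remains is the cohomology of `J_B`
(`postcompBijective_of_isKProjective_of_isKInjective`, `PostcompBijective.adjunct`).

K-injective resolutions of unbounded complexes are built by hand, as the limit of a tower that
starts at the cone of `𝟙 W` and is enlarged by injectives which kill the cohomology of the cokernel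
of `W`. -/

namespace RHomComparison

open CochainComplex HomComplex Limits

/-! ### Quasi-isomorphisms of complexes of modules, by elements -/

section QuasiIsoCriterion

variable {R : Type u} [Ring R]

/-- The fibre product of `g` and `h` serves as `A'`. This turns elementwise lifting, with no linear
choice of lifts, into lifting up to refinement. -/
lemma exists_epi_refinement {A M N : ModuleCat.{v} R} (g : A ⟶ M) (h : N ⟶ M)
    (H : ∀ a : A, ∃ n : N, h n = g a) :
    ∃ (A' : ModuleCat.{v} R) (π : A' ⟶ A) (_ : Epi π) (x : A' ⟶ N), π ≫ g = x ≫ h := by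
  let S := LinearMap.eqLocus (g.hom ∘ₗ LinearMap.fst R A N) (h.hom ∘ₗ LinearMap.snd R A N)
  refine ⟨ModuleCat.of R S, ModuleCat.ofHom (LinearMap.fst R A N ∘ₗ S.subtype), ?_,
    ModuleCat.ofHom (LinearMap.snd R A N ∘ₗ S.subtype), ?_⟩
  · rw [ModuleCat.epi_iff_surjective]
    intro a
    obtain ⟨n, hn⟩ := H a
    exact ⟨⟨(a, n), hn.symm⟩, rfl⟩
  · ext ⟨x, hx⟩
    exact hx

lemma quasiIso_of_forall_elements {K L : CochainComplex (ModuleCat.{v} R) ℤ} (φ : K ⟶ L)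
    (hinj : ∀ (i j k : ℤ), i + 1 = j → j + 1 = k → ∀ x : K.X j, K.d j k x = 0 →
      ∀ y : L.X i, φ.f j x = L.d i j y → ∃ z : K.X i, K.d i j z = x)
    (hsurj : ∀ (i j k : ℤ), i + 1 = j → j + 1 = k → ∀ y : L.X j, L.d j k y = 0 →
      ∃ (x : K.X j) (z : L.X i), K.d j k x = 0 ∧ φ.f j x + L.d i j z = y) :
    QuasiIso φ := by
  rw [quasiIso_iff]
  intro j
  rw [quasiIsoAt_iff_isIso_homologyMap, isIso_iff_mono_and_epi]
  constructor
  · rw [HomologicalComplex.mono_homologyMap_iff_up_to_refinements φ (j - 1) j (j + 1)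
      (by simp) (by simp)]
    intro A x₂ hx₂ y₁ hy₁
    refine exists_epi_refinement x₂ (K.d (j - 1) j) fun a =>
      hinj _ _ (j + 1) (by simp) rfl (x₂ a) (ConcreteCategory.congr_hom hx₂ a) (y₁ a)
        (ConcreteCategory.congr_hom hy₁ a)
  · rw [HomologicalComplex.epi_homologyMap_iff_up_to_refinements φ (j - 1) j (j + 1)
      (by simp) (by simp)]
    intro A y₂ hy₂
    let Z := LinearMap.ker (K.d j (j + 1)).hom
    let p : ModuleCat.of R (Z × L.X (j - 1)) ⟶ K.X j :=
      ModuleCat.ofHom (Z.subtype ∘ₗ LinearMap.fst R Z (L.X (j - 1)))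
    let q : ModuleCat.of R (Z × L.X (j - 1)) ⟶ L.X (j - 1) :=
      ModuleCat.ofHom (LinearMap.snd R Z (L.X (j - 1)))
    obtain ⟨A', π, hπ, x, hx⟩ := exists_epi_refinement y₂ (p ≫ φ.f j + q ≫ L.d (j - 1) j)
      (fun a => by
        obtain ⟨x, z, hx, hz⟩ := hsurj (j - 1) j (j + 1) (by simp) rfl (y₂ a)
          (ConcreteCategory.congr_hom hy₂ a)
        exact ⟨(⟨x, hx⟩, z), hz⟩)
    refine ⟨A', π, hπ, x ≫ p, ?_, x ≫ q, by simpa using hx⟩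
    ext a
    exact (x a).1.2

end QuasiIsoCriterion

/-! ### Extensions of a complex by injectives with zero differential -/

section Twist

variable {R : Type u} [Ring R]

/-- The extension of `X` by a complex `E` with zero differential (placed so that a term `E n`
sits in degree `n`), with the twisted differential `(x, e) ↦ (d x, h x)`. -/
noncomputable def twist (X : CochainComplex (ModuleCat.{v} R) ℤ) (E : ℤ → ModuleCat.{v} R)
    (h : ∀ i j : ℤ, X.X i ⟶ E j) (shape : ∀ i j, ¬ i + 1 = j → h i j = 0)
    (comp : ∀ i j k, X.d i j ≫ h j k = 0) : CochainComplex (ModuleCat.{v} R) ℤ where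
  X i := ModuleCat.of R (X.X i × E i)
  d i j := ModuleCat.ofHom
    (((X.d i j).hom.prod (h i j).hom) ∘ₗ LinearMap.fst R (X.X i) (E i))
  shape i j hij := by
    rw [shape i j hij, X.shape i j hij]
    rfl
  d_comp_d' i j k _ _ := ModuleCat.hom_ext <| LinearMap.ext fun x => Prod.ext
    (ConcreteCategory.congr_hom (X.d_comp_d i j k) x.1)
    (ConcreteCategory.congr_hom (comp i j k) x.1)

variable {X : CochainComplex (ModuleCat.{v} R) ℤ} {E : ℤ → ModuleCat.{v} R}
  {h : ∀ i j : ℤ, X.X i ⟶ E j} {shape : ∀ i j, ¬ i + 1 = j → h i j = 0}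
  {comp : ∀ i j k, X.d i j ≫ h j k = 0}

variable (X E h shape comp) in
/-- The projection from a twisted extension. -/
noncomputable def twistFst : twist X E h shape comp ⟶ X where
  f i := ModuleCat.ofHom (LinearMap.fst R (X.X i) (E i))

variable (X E h shape comp) in
/-- The second projection from the components of a twisted extension. -/
noncomputable def twistSnd (i : ℤ) : (twist X E h shape comp).X i ⟶ E i :=
  ModuleCat.ofHom (LinearMap.snd R (X.X i) (E i))

variable (X E h shape comp) in
/-- The morphism to a component of a twisted extension given by two morphisms. -/
noncomputable def twistPair {M : ModuleCat.{v} R} (i : ℤ) (a : M ⟶ X.X i) (b : M ⟶ E i) :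
    M ⟶ (twist X E h shape comp).X i :=
  ModuleCat.ofHom (a.hom.prod b.hom)

lemma twistPair_fst {M : ModuleCat.{v} R} (i : ℤ) (a : M ⟶ X.X i) (b : M ⟶ E i) :
    twistPair X E h shape comp i a b ≫ (twistFst X E h shape comp).f i = a := rfl

lemma twistPair_fst_assoc {M N : ModuleCat.{v} R} (i : ℤ) (a : M ⟶ X.X i) (b : M ⟶ E i)
    (g : X.X i ⟶ N) :
    twistPair X E h shape comp i a b ≫ (twistFst X E h shape comp).f i ≫ g = a ≫ g := rfl

lemma twistPair_snd {M : ModuleCat.{v} R} (i : ℤ) (a : M ⟶ X.X i) (b : M ⟶ E i) :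
    twistPair X E h shape comp i a b ≫ twistSnd X E h shape comp i = b := rfl

lemma twist_d_fst (i j : ℤ) : (twist X E h shape comp).d i j ≫ (twistFst X E h shape comp).f j =
    (twistFst X E h shape comp).f i ≫ X.d i j := rfl

lemma twist_d_snd (i j : ℤ) : (twist X E h shape comp).d i j ≫ twistSnd X E h shape comp j =
    (twistFst X E h shape comp).f i ≫ h i j := rfl

lemma twist_hom_ext {M : ModuleCat.{v} R} {i : ℤ} {a b : M ⟶ (twist X E h shape comp).X i}
    (h₁ : a ≫ (twistFst X E h shape comp).f i = b ≫ (twistFst X E h shape comp).f i)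
    (h₂ : a ≫ twistSnd X E h shape comp i = b ≫ twistSnd X E h shape comp i) : a = b :=
  ModuleCat.hom_ext <| LinearMap.ext fun x => Prod.ext (ConcreteCategory.congr_hom h₁ x)
    (ConcreteCategory.congr_hom h₂ x)

variable (E h shape comp) in
/-- The lift to a twisted extension of a morphism killed by `h`. -/
noncomputable def twistLift {W : CochainComplex (ModuleCat.{v} R) ℤ} (f : W ⟶ X)
    (hf : ∀ i j, f.f i ≫ h i j = 0) : W ⟶ twist X E h shape comp where
  f i := twistPair X E h shape comp i (f.f i) 0
  comm' i j _ := twist_hom_ext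
    (by simp [← f.comm, twistPair_fst, twistPair_fst_assoc, -HomologicalComplex.Hom.comm, twist_d_fst])
    (by simp [twistPair_snd, twistPair_fst_assoc, twist_d_snd, hf])

/-- The first component of the null-homotopy is `α` itself. The second must extend the defect `f₂ -
α h` along `Z.d`; the defect vanishes on boundaries, so exactness of `Z` and injectivity of `E i`
give the extension. -/
lemma exists_cochain_to_twist [∀ i, Injective (E i)] {Z : CochainComplex (ModuleCat.{v} R) ℤ}
    (hZ : Z.Acyclic) (f : Z ⟶ twist X E h shape comp) (α : Cochain Z X (-1))
    (hα : δ (-1) 0 α = Cochain.ofHom (f ≫ twistFst X E h shape comp)) :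
    ∃ β : Cochain Z (twist X E h shape comp) (-1), δ (-1) 0 β = Cochain.ofHom f ∧
      β.comp (Cochain.ofHom (twistFst X E h shape comp)) (add_zero _) = α := by
  have hα' (i : ℤ) : α.v i (i - 1) (by lia) ≫ X.d (i - 1) i +
      Z.d i (i + 1) ≫ α.v (i + 1) i (by lia) =
        f.f i ≫ (twistFst X E h shape comp).f i := by
    have := Cochain.congr_v hα i i (by lia)
    rw [δ_v (-1) 0 (by lia) α i i (by lia) (i - 1) (i + 1) (by lia) (by lia)] at this
    simpa using this
  have key (i : ℤ) : ∃ γ : Z.X (i + 1) ⟶ E i, Z.d i (i + 1) ≫ γ =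
      f.f i ≫ twistSnd X E h shape comp i - α.v i (i - 1) (by lia) ≫ h (i - 1) i := by
    have ex := hZ i
    rw [HomologicalComplex.exactAt_iff' _ (i - 1) i (i + 1) (by simp) (by simp)] at ex
    refine ⟨ex.descToInjective (f.f i ≫ twistSnd X E h shape comp i - α.v i (i - 1) (by lia) ≫ h (i - 1) i) ?_,
      ex.comp_descToInjective _ _⟩
    have h1 := hα' (i - 1)
    change Z.d (i - 1) i ≫ _ = 0
    have e : Z.d (i - 1) i ≫ α.v i (i - 1) (by lia) = f.f (i - 1) ≫
        (twistFst X E h shape comp).f (i - 1) -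
        α.v (i - 1) (i - 1 - 1) (by lia) ≫ X.d (i - 1 - 1) (i - 1) := by
      rw [← h1, add_sub_cancel_left]
      congr! <;> lia
    rw [Preadditive.comp_sub, ← f.comm_assoc, twist_d_snd, reassoc_of% e]
    simp [comp]
  choose γ hγ using key
  let β : Cochain Z (twist X E h shape comp) (-1) := Cochain.mk fun p q hpq =>
    twistPair X E h shape comp q (α.v p q hpq) ((Z.XIsoOfEq (by lia : p = q + 1)).hom ≫ γ q)
  refine ⟨β, ?_, ?_⟩
  · ext1 i
    rw [δ_v (-1) 0 (by lia) β i i (by lia) (i - 1) (i + 1) (by lia) (by lia)]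
    refine twist_hom_ext ?_ ?_
    · simpa [β, twistPair_fst, twistPair_fst_assoc, -HomologicalComplex.Hom.comm, twist_d_fst] using hα' i
    · simp [β, twistPair_snd, twistPair_fst_assoc, twist_d_snd, hγ]
  · ext p q hpq : 1
    simp [β, twistPair_fst]

end Twist

/-! ### The tower of complexes under `W` -/

section Tower

variable {R : Type u} [Ring R]

/-- `X / (im d + im f)` is embedded in an injective, so that `h` kills exactly `im d + im f`. -/
lemma exists_twist_datum {W X : CochainComplex (ModuleCat.{u} R) ℤ} (f : W ⟶ X) :
    ∃ (E : ℤ → ModuleCat.{u} R) (h : ∀ i j : ℤ, X.X i ⟶ E j), (∀ i, Injective (E i)) ∧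
      (∀ i j, ¬ i + 1 = j → h i j = 0) ∧ (∀ i j k, X.d i j ≫ h j k = 0) ∧
      (∀ i j, f.f i ≫ h i j = 0) ∧
      ∀ j k : ℤ, j + 1 = k → ∀ x : X.X j, h j k x = 0 →
        ∃ (y : X.X (j - 1)) (w : W.X j), x = X.d (j - 1) j y + f.f j w := by
  let S (i : ℤ) : Submodule R (X.X i) :=
    LinearMap.range (X.d (i - 1) i).hom ⊔ LinearMap.range (f.f i).hom
  let q (i : ℤ) : X.X i ⟶ ModuleCat.of R (X.X i ⧸ S i) := ModuleCat.ofHom (S i).mkQ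
  have hq (i : ℤ) (x : X.X i) : q i x = 0 ↔ x ∈ S i := Submodule.Quotient.mk_eq_zero _
  -- The shift by one makes `h` raise degrees by one, as a differential must.
  let E (j : ℤ) : ModuleCat.{u} R :=
    Injective.under (ModuleCat.of R (X.X (j - 1) ⧸ S (j - 1)))
  let h (i j : ℤ) : X.X i ⟶ E j :=
    if hij : i = j - 1 then (X.XIsoOfEq hij).hom ≫ q (j - 1) ≫ Injective.ι _ else 0
  have hdef (j : ℤ) : h (j - 1) j = q (j - 1) ≫ Injective.ι _ := by simp [h]
  have hzero (i j : ℤ) (hij : ¬ i + 1 = j) : h i j = 0 := dif_neg (by lia)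
  refine ⟨E, h, fun i => inferInstance, hzero, fun i j k => ?_, fun i j => ?_,
    fun j k hjk x hx => ?_⟩
  · by_cases hjk : j + 1 = k
    · obtain rfl : j = k - 1 := by lia
      by_cases hij : i + 1 = k - 1
      · obtain rfl : i = k - 1 - 1 := by lia
        rw [hdef, ← Category.assoc]
        convert zero_comp
        ext x
        exact (hq _ _).2 (Submodule.mem_sup_left ⟨x, rfl⟩)
      · rw [X.shape _ _ hij, zero_comp]
    · rw [hzero _ _ hjk, comp_zero]
  · by_cases hij : i + 1 = j
    · obtain rfl : i = j - 1 := by lia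
      rw [hdef, ← Category.assoc]
      convert zero_comp
      ext x
      exact (hq _ _).2 (Submodule.mem_sup_right ⟨x, rfl⟩)
    · rw [hzero _ _ hij, comp_zero]
  · obtain rfl : j = k - 1 := by lia
    rw [hdef] at hx
    have hx' : q (k - 1) x = 0 :=
      (ModuleCat.mono_iff_injective (Injective.ι (ModuleCat.of R (X.X (k - 1) ⧸ S (k - 1))))).1
        inferInstance (hx.trans (map_zero _).symm)
    obtain ⟨_, ⟨y, rfl⟩, _, ⟨w, rfl⟩, rfl⟩ := Submodule.mem_sup.1 ((hq _ _).1 hx')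
    exact ⟨y, w, rfl⟩

/-- The property of a morphism `π` that null-homotopies of morphisms from acyclic
complexes lift along `π`. -/
def LiftsNullHomotopies {X Y : CochainComplex (ModuleCat.{u} R) ℤ} (π : Y ⟶ X) : Prop :=
  ∀ ⦃Z : CochainComplex (ModuleCat.{u} R) ℤ⦄, Z.Acyclic → ∀ (g : Z ⟶ Y) (α : Cochain Z X (-1)),
    δ (-1) 0 α = Cochain.ofHom (g ≫ π) →
      ∃ β : Cochain Z Y (-1), δ (-1) 0 β = Cochain.ofHom g ∧
        β.comp (Cochain.ofHom π) (add_zero _) = α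

/-- In the twisted extension, `d z = g w` forces the `E`-component `h z` to vanish, since `g = (f,
0)`. Thus a cocycle modulo `W` upstairs becomes a boundary modulo `W` downstairs: `π` is zero on the
cohomology of the cokernels. -/
lemma exists_stage {W X : CochainComplex (ModuleCat.{u} R) ℤ} (f : W ⟶ X) :
    ∃ (Y : CochainComplex (ModuleCat.{u} R) ℤ) (g : W ⟶ Y) (π : Y ⟶ X), g ≫ π = f ∧
      (∀ i, Function.Surjective (π.f i)) ∧ LiftsNullHomotopies π ∧
      ∀ (j k : ℤ), j + 1 = k → ∀ (z : Y.X j) (w : W.X k), Y.d j k z = g.f k w →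
        ∃ (a : X.X (j - 1)) (v : W.X j), π.f j z = X.d (j - 1) j a + f.f j v := by
  obtain ⟨E, h, hE, shape, comp, hf, key⟩ := exists_twist_datum f
  refine ⟨twist X E h shape comp, twistLift E h shape comp f hf, twistFst X E h shape comp,
    rfl, fun i x => ⟨(x, 0), rfl⟩, fun Z hZ g α hα => exists_cochain_to_twist hZ g α hα,
    fun j k hjk z w hz => ?_⟩
  exact key j k hjk _ (congr_arg Prod.snd hz)

lemma exists_tower (W : CochainComplex (ModuleCat.{u} R) ℤ) :
    ∃ (X : ℕ → CochainComplex (ModuleCat.{u} R) ℤ) (f : ∀ n, W ⟶ X n)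
      (π : ∀ n, X (n + 1) ⟶ X n), Nonempty (Homotopy (𝟙 (X 0)) 0) ∧
      (∀ i, Function.Injective ((f 0).f i)) ∧ ∀ n, f (n + 1) ≫ π n = f n ∧
      (∀ i, Function.Surjective ((π n).f i)) ∧ LiftsNullHomotopies (π n) ∧
      ∀ (j k : ℤ), j + 1 = k → ∀ (z : (X (n + 1)).X j) (w : W.X k),
        (X (n + 1)).d j k z = (f (n + 1)).f k w →
        ∃ (a : (X n).X (j - 1)) (v : W.X j),
          (π n).f j z = (X n).d (j - 1) j a + (f n).f j v := by
  choose Y g π h using fun (S : Σ X : CochainComplex (ModuleCat.{u} R) ℤ, W ⟶ X) =>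
    exists_stage S.2
  -- The cone of the identity is contractible, which starts the lifting of null-homotopies, and it
  -- contains `W`.
  let T : ℕ → Σ X : CochainComplex (ModuleCat.{u} R) ℤ, W ⟶ X :=
    Nat.rec ⟨mappingCone (𝟙 W), mappingCone.inr (𝟙 W)⟩ fun _ S => ⟨Y S, g S⟩
  refine ⟨fun n => (T n).1, fun n => (T n).2, fun n => π (T n),
    ⟨mappingCone.homotopyToZeroOfId W⟩, fun i => ?_, fun n => h (T n)⟩
  rw [← ModuleCat.mono_iff_injective]
  exact mono_of_mono_fac (mappingCone.inr_f_snd_v (𝟙 W) i)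

end Tower

/-! ### K-injectivity of the limit of the tower -/

section TowerLimit

variable {R : Type u} [Ring R] (X : ℕ → CochainComplex (ModuleCat.{u} R) ℤ)
  (π : ∀ n, X (n + 1) ⟶ X n)

/-- The compatible families of elements of degree `i` in a tower of complexes. -/
def compatibleFamilies (i : ℤ) : Submodule R (∀ n, (X n).X i) where
  carrier := Set.ofPred fun x => ∀ n, (π n).f i (x (n + 1)) = x n
  add_mem' hx hy n := by simp [hx n, hy n]
  zero_mem' n := by simp
  smul_mem' r x hx n := by simp [hx n]

/-- The limit of a tower of complexes of modules. -/
noncomputable def towerLimit : CochainComplex (ModuleCat.{u} R) ℤ where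
  X i := ModuleCat.of R (compatibleFamilies X π i)
  d i j := ModuleCat.ofHom (LinearMap.restrict
    (LinearMap.pi fun n => ((X n).d i j).hom ∘ₗ LinearMap.proj n)
    fun x hx n => by
      have := ConcreteCategory.congr_hom ((π n).comm i j) (x (n + 1))
      exact this.symm.trans (congr_arg ((X n).d i j) (hx n)))
  shape i j hij := by
    ext x n
    exact ConcreteCategory.congr_hom ((X n).shape i j hij) (x.1 n)
  d_comp_d' i j k _ _ := by
    ext x n
    exact ConcreteCategory.congr_hom ((X n).d_comp_d i j k) (x.1 n)

/-- The projections from the limit of a tower of complexes. -/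
noncomputable def towerLimitπ (n : ℕ) : towerLimit X π ⟶ X n where
  f i := ModuleCat.ofHom (LinearMap.proj n ∘ₗ (compatibleFamilies X π i).subtype)

variable {X π}

/-- The morphism to a component of the limit of a tower given by a compatible family. -/
noncomputable def towerLimitPair {M : ModuleCat.{u} R} (i : ℤ) (a : ∀ n, M ⟶ (X n).X i)
    (ha : ∀ n, a (n + 1) ≫ (π n).f i = a n) : M ⟶ (towerLimit X π).X i :=
  ModuleCat.ofHom (LinearMap.codRestrict _ (LinearMap.pi fun n => (a n).hom)
    fun x n => ConcreteCategory.congr_hom (ha n) x)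

lemma towerLimitPair_π {M : ModuleCat.{u} R} (i : ℤ) (a : ∀ n, M ⟶ (X n).X i)
    (ha : ∀ n, a (n + 1) ≫ (π n).f i = a n) (n : ℕ) :
    towerLimitPair i a ha ≫ (towerLimitπ X π n).f i = a n := rfl

lemma towerLimit_hom_ext {M : ModuleCat.{u} R} {i : ℤ} {a b : M ⟶ (towerLimit X π).X i}
    (h : ∀ n, a ≫ (towerLimitπ X π n).f i = b ≫ (towerLimitπ X π n).f i) : a = b :=
  ModuleCat.hom_ext <| LinearMap.ext fun x => Subtype.ext <| funext fun n =>
    ConcreteCategory.congr_hom (h n) x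

lemma towerLimitπ_comp (n : ℕ) : towerLimitπ X π (n + 1) ≫ π n = towerLimitπ X π n := by
  ext i x
  exact x.2 n

/-- The morphism to the limit of a tower given by a compatible family. -/
noncomputable def towerLimitLift {W : CochainComplex (ModuleCat.{u} R) ℤ} (f : ∀ n, W ⟶ X n)
    (hf : ∀ n, f (n + 1) ≫ π n = f n) : W ⟶ towerLimit X π where
  f i := towerLimitPair i (fun n => (f n).f i) fun n => by rw [← hf n]; rfl
  comm' i j _ := towerLimit_hom_ext fun n => (f n).comm i j

/-- A null-homotopy into the contractible `X 0` is lifted stage by stage. The lifts are strictly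
compatible, so they assemble to a null-homotopy into the limit. -/
lemma isKInjective_towerLimit (h₀ : Nonempty (Homotopy (𝟙 (X 0)) 0))
    (hπ : ∀ n, LiftsNullHomotopies (π n)) : (towerLimit X π).IsKInjective where
  nonempty_homotopy_zero {Z} g hZ := by
    obtain ⟨H⟩ := h₀
    have base : ∃ α : Cochain Z (X 0) (-1),
        δ (-1) 0 α = Cochain.ofHom (g ≫ towerLimitπ X π 0) := by
      obtain ⟨α, hα⟩ := Cochain.equivHomotopy _ _
        (((Homotopy.ofEq (Category.comp_id (g ≫ towerLimitπ X π 0)).symm).trans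
          (H.compLeft (g ≫ towerLimitπ X π 0))).trans (Homotopy.ofEq (by simp)) :
          Homotopy (g ≫ towerLimitπ X π 0) 0)
      exact ⟨α, by simpa using hα.symm⟩
    let T (n : ℕ) := {α : Cochain Z (X n) (-1) //
      δ (-1) 0 α = Cochain.ofHom (g ≫ towerLimitπ X π n)}
    have step (n : ℕ) (α : T n) : ∃ β : T (n + 1),
        β.1.comp (Cochain.ofHom (π n)) (add_zero _) = α.1 := by
      obtain ⟨β, hβ, hβ'⟩ := hπ n hZ (g ≫ towerLimitπ X π (n + 1)) α.1
        (by rw [Category.assoc, towerLimitπ_comp, α.2])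
      exact ⟨⟨β, hβ⟩, hβ'⟩
    choose next hnext using step
    let α (n : ℕ) : T n := Nat.rec ⟨_, base.choose_spec⟩ (fun n a => next n a) n
    have hα (n : ℕ) : (α (n + 1)).1.comp (Cochain.ofHom (π n)) (add_zero _) = (α n).1 :=
      hnext n (α n)
    let β : Cochain Z (towerLimit X π) (-1) := Cochain.mk fun p q hpq =>
      towerLimitPair q (fun n => (α n).1.v p q hpq) fun n => by
        rw [← hα n]
        simp
    refine ⟨(Cochain.equivHomotopy g 0).symm ⟨β, ?_⟩⟩
    have hβ (n : ℕ) : β.comp (Cochain.ofHom (towerLimitπ X π n)) (add_zero _) = (α n).1 := by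
      ext p q hpq : 1
      simp [β, towerLimitPair_π]
    rw [Cochain.ofHom_zero, add_zero]
    ext1 i
    refine towerLimit_hom_ext fun n => ?_
    have := Cochain.congr_v (α n).2 i i (by lia)
    rw [← hβ n, δ_comp_ofHom] at this
    simpa using this.symm

end TowerLimit

/-! ### The limit resolves `W` -/

section ExistenceOfResolutions

variable {R : Type u} [Ring R]

lemma d_apply_hom_apply {K L : CochainComplex (ModuleCat.{v} R) ℤ} (φ : K ⟶ L) (i j : ℤ)
    (x : K.X i) : L.d i j (φ.f i x) = φ.f j (K.d i j x) :=
  ConcreteCategory.congr_hom (φ.comm i j) x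

lemma d_apply_d_apply (K : CochainComplex (ModuleCat.{v} R) ℤ) (i j k : ℤ) (x : K.X i) :
    K.d j k (K.d i j x) = 0 :=
  ConcreteCategory.congr_hom (K.d_comp_d i j k) x

variable {W : CochainComplex (ModuleCat.{u} R) ℤ} {X : ℕ → CochainComplex (ModuleCat.{u} R) ℤ}
  {f : ∀ n, W ⟶ X n} {π : ∀ n, X (n + 1) ⟶ X n}

/-- A Mittag-Leffler argument for the acyclicity of the cokernel of `W` in the limit: primitives at
each stage are corrected until their images one stage lower are compatible. -/
lemma exists_eq_d_add_towerLimitLift (hf : ∀ n, f (n + 1) ≫ π n = f n)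
    (hinj : ∀ i, Function.Injective ((f 0).f i))
    (hπ : ∀ n i, Function.Surjective ((π n).f i))
    (key : ∀ (n : ℕ) (j k : ℤ), j + 1 = k → ∀ (z : (X (n + 1)).X j) (w : W.X k),
        (X (n + 1)).d j k z = (f (n + 1)).f k w →
        ∃ (a : (X n).X (j - 1)) (v : W.X j),
          (π n).f j z = (X n).d (j - 1) j a + (f n).f j v)
    (j k : ℤ) (hjk : j + 1 = k) (x : (towerLimit X π).X j) (w : W.X k)
    (hx : (towerLimit X π).d j k x = (towerLimitLift f hf).f k w) :
    ∃ (y : (towerLimit X π).X (j - 1)) (v : W.X j),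
      x = (towerLimit X π).d (j - 1) j y + (towerLimitLift f hf).f j v := by
  have hπf (n : ℕ) (i : ℤ) (u : W.X i) : (π n).f i ((f (n + 1)).f i u) = (f n).f i u := by
    rw [← hf n]
    rfl
  have hinj' (n : ℕ) (i : ℤ) : Function.Injective ((f n).f i) := by
    induction n with
    | zero => exact hinj i
    | succ n ih => exact fun u v huv => ih (by rw [← hπf n, ← hπf n, huv])
  have hxn (n : ℕ) : (X n).d j k (x.1 n) = (f n).f k w :=
    congr_fun (congr_arg Subtype.val hx) n
  have hxπ (n : ℕ) : (π n).f j (x.1 (n + 1)) = x.1 n := x.2 n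
  -- Each use of `key` loses one stage. The element `w'` chosen here is kept at all stages.
  obtain ⟨b₀, w', hb₀⟩ := key 1 j k hjk (x.1 2) w (hxn 2)
  rw [hxπ 1] at hb₀
  let B (n : ℕ) := {b : (X (n + 1)).X (j - 1) //
    x.1 (n + 1) = (X (n + 1)).d (j - 1) j b + (f (n + 1)).f j w'}
  have step (n : ℕ) (b : B n) : ∃ b' : B (n + 1),
      (π n).f _ ((π (n + 1)).f _ b'.1) = (π n).f _ b.1 := by
    obtain ⟨b, hb⟩ := b
    obtain ⟨y, w'', hy⟩ := key (n + 2) j k hjk (x.1 (n + 3)) w (hxn (n + 3))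
    rw [hxπ (n + 2)] at hy
    have hy' : x.1 (n + 1) = (X (n + 1)).d (j - 1) j ((π (n + 1)).f _ y) +
        (f (n + 1)).f j w'' := by
      rw [← hxπ (n + 1), hy, map_add, hπf, d_apply_hom_apply]
    have hz : (X (n + 1)).d (j - 1) j ((π (n + 1)).f _ y - b) =
        (f (n + 1)).f j (w' - w'') := by
      rw [map_sub, map_sub, sub_eq_sub_iff_add_eq_add, ← hy', hb]
      exact add_comm _ _
    -- The new primitive `y` and the old `b` differ by a cocycle modulo `W`, hence by `d a + f v`
    -- one stage lower. Subtracting lifts of both terms from `y` restores compatibility and changes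
    -- `w''` back to `w'`.
    obtain ⟨a, v, hav⟩ := key n (j - 1) j (by lia) _ _ hz
    have hv : W.d (j - 1) j v = w' - w'' := by
      apply hinj' n
      have := congr_arg ((X n).d (j - 1) j) hav
      rw [d_apply_hom_apply, hz, hπf, map_add, d_apply_d_apply, zero_add,
        d_apply_hom_apply] at this
      exact this.symm
    obtain ⟨a', ha'⟩ := hπ n _ a
    obtain ⟨a'', ha''⟩ := hπ (n + 1) _ a'
    refine ⟨⟨y - (X (n + 2)).d _ _ a'' - (f (n + 2)).f _ v, ?_⟩, ?_⟩
    · rw [map_sub, map_sub, d_apply_d_apply, d_apply_hom_apply, hv, hy, map_sub]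
      abel
    · simp only [map_sub, hπf, ← d_apply_hom_apply, ha'', ha'] at hav ⊢
      rw [sub_sub, ← hav, sub_sub_cancel]
  choose next hnext using step
  let b (n : ℕ) : B n := Nat.rec ⟨b₀, hb₀⟩ (fun n b => next n b) n
  have hb (n : ℕ) : (π n).f _ ((π (n + 1)).f _ (b (n + 1)).1) = (π n).f _ (b n).1 :=
    hnext n (b n)
  refine ⟨⟨fun n => (π n).f _ (b n).1, hb⟩, w', Subtype.ext (funext fun n => ?_)⟩
  change x.1 n = (X n).d (j - 1) j ((π n).f _ (b n).1) + (f n).f j w'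
  refine (hxπ n).symm.trans ((congr_arg ((π n).f j) (b n).2).trans ?_)
  rw [map_add, hπf, d_apply_hom_apply]

variable (R) in
lemma enoughKInjectives_moduleCat : EnoughKInjectives (ModuleCat.{u} R) := by
  intro W
  obtain ⟨X, f, π, h₀, hinj, h⟩ := exists_tower W
  have hf (n : ℕ) : f (n + 1) ≫ π n = f n := (h n).1
  have key := exists_eq_d_add_towerLimitLift hf hinj (fun n => (h n).2.1)
    (fun n => (h n).2.2.2)
  have hmono (i : ℤ) : Function.Injective ((towerLimitLift f hf).f i) := fun u v huv =>
    hinj i (congr_fun (congr_arg Subtype.val huv) 0)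
  refine ⟨⟨towerLimit X π, towerLimitLift f hf,
    isKInjective_towerLimit h₀ fun n => (h n).2.2.1, quasiIso_of_forall_elements _ ?_ ?_⟩⟩
  · intro i j k hij hjk u hu y hy
    obtain ⟨z, v, rfl⟩ := key i j hij y u hy.symm
    refine ⟨v, hmono j ?_⟩
    rw [hy, map_add, d_apply_d_apply, zero_add, d_apply_hom_apply]
  · intro i j k hij hjk y hy
    obtain rfl : i = j - 1 := by lia
    obtain ⟨z, v, rfl⟩ := key j k hjk y 0 (by rw [hy, map_zero])
    refine ⟨v, z, hmono k ?_, add_comm _ _⟩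
    rwa [map_add, d_apply_d_apply, zero_add, d_apply_hom_apply, ← map_zero
      ((towerLimitLift f hf).f k).hom] at hy

end ExistenceOfResolutions

/-! ### Homotopy invariance of the Hom complex -/

section Postcomposition

variable {C : Type u} [Category.{v} C] [Abelian C] (V : CochainComplex C ℤ)
  {K L M : CochainComplex C ℤ}

lemma homComplexPostcomp_comp (φ : K ⟶ L) (ψ : L ⟶ M) :
    homComplexPostcomp V (φ ≫ ψ) = homComplexPostcomp V φ ≫ homComplexPostcomp V ψ := by
  ext n z
  have (z : Cochain V K n) : z.comp (Cochain.ofHom (φ ≫ ψ)) (add_zero n) =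
      (z.comp (Cochain.ofHom φ) (add_zero n)).comp (Cochain.ofHom ψ) (add_zero n) := by
    simp [Cochain.ofHom_comp]
  exact this z

lemma homComplexPostcomp_id : homComplexPostcomp V (𝟙 K) = 𝟙 _ := by
  ext n z
  exact Cochain.comp_id z

variable {V} in
/-- Postcomposition with a fixed cochain. -/
noncomputable def postcompCochain {n : ℤ} (α : Cochain K L n) (i j : ℤ) (hij : i + n = j) :
    (HomComplex V K).X i ⟶ (HomComplex V L).X j :=
  AddCommGrpCat.ofHom
    { toFun := fun z => Cochain.comp z α hij
      map_zero' := Cochain.zero_comp _ _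
      map_add' := fun _ _ => Cochain.add_comp _ _ _ _ }

/-- Postcomposition with homotopic morphisms gives homotopic morphisms. -/
noncomputable def homComplexPostcompHomotopy {φ ψ : K ⟶ L} (H : Homotopy φ ψ) :
    Homotopy (homComplexPostcomp V φ) (homComplexPostcomp V ψ) where
  hom i j := if hij : j + 1 = i then
    postcompCochain (Cochain.ofHomotopy H) i j (by lia) else 0
  zero i j hij := dif_neg hij
  comm i := by
    rw [dNext_eq _ (show (ComplexShape.up ℤ).Rel i (i + 1) from rfl),
      prevD_eq _ (show (ComplexShape.up ℤ).Rel (i - 1) i by simp), dif_pos rfl,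
      dif_pos (by simp)]
    ext z
    have (z : Cochain V K i) : z.comp (Cochain.ofHom φ) (add_zero i) =
        (δ i (i + 1) z).comp (Cochain.ofHomotopy H) (by lia) +
          δ (i - 1) i (z.comp (Cochain.ofHomotopy H) (by lia)) +
          z.comp (Cochain.ofHom ψ) (add_zero i) := by
      -- The Leibniz sign for a homotopy, of degree `-1`, makes the two terms in `δ z` cancel.
      rw [δ_comp z (Cochain.ofHomotopy H) (by lia) (i + 1) 0 i (by lia) rfl (by lia),
        δ_ofHomotopy]
      simp
    exact this z

lemma isIso_Q_map_homComplexPostcomp [HasDerivedCategory.{w} AddCommGrpCat.{v}]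
    (e : HomotopyEquiv K L) : IsIso (DerivedCategory.Q.map (homComplexPostcomp V e.hom)) := by
  refine ⟨DerivedCategory.Q.map (homComplexPostcomp V e.inv), ?_, ?_⟩
  · rw [← Functor.map_comp, ← homComplexPostcomp_comp,
      DerivedCategory.Q_map_eq_of_homotopy _ (homComplexPostcompHomotopy V e.homotopyHomInvId),
      homComplexPostcomp_id, CategoryTheory.Functor.map_id]
  · rw [← Functor.map_comp, ← homComplexPostcomp_comp,
      DerivedCategory.Q_map_eq_of_homotopy _ (homComplexPostcompHomotopy V e.homotopyInvHomId),
      homComplexPostcomp_id, CategoryTheory.Functor.map_id]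

end Postcomposition

/-! ### Comparison through the right adjoint -/

section Adjunction

variable {C₁ : Type u₁} [Category.{v} C₁] [Abelian C₁]
  {C₂ : Type u₂} [Category.{v} C₂] [Abelian C₂]
  {F : C₂ ⥤ C₁} [F.Additive] {G : C₁ ⥤ C₂} [G.Additive] (adj : F ⊣ G)

/-- The counit on complexes. -/
noncomputable def counitOnComplexes (J : CochainComplex C₁ ℤ) :
    (onComplexes F).obj ((onComplexes G).obj J) ⟶ J where
  f i := adj.counit.app (J.X i)
  comm' i j _ := (adj.counit.naturality (J.d i j)).symm

/-- The adjunct of a morphism of complexes. -/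
noncomputable def adjunct {K : CochainComplex C₂ ℤ} {J : CochainComplex C₁ ℤ}
    (φ : (onComplexes F).obj K ⟶ J) : K ⟶ (onComplexes G).obj J where
  f i := adj.homEquiv _ _ (φ.f i)
  comm' i j _ := by
    exact (adj.homEquiv_naturality_right _ _).symm.trans
      ((congr_arg (adj.homEquiv _ _) (φ.comm i j)).trans (adj.homEquiv_naturality_left _ _))

lemma map_adjunct_comp_counit {K : CochainComplex C₂ ℤ} {J : CochainComplex C₁ ℤ}
    (φ : (onComplexes F).obj K ⟶ J) :
    (onComplexes F).map (adjunct adj φ) ≫ counitOnComplexes adj J = φ := by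
  ext i
  exact (adj.homEquiv_counit _ _ _).symm.trans ((adj.homEquiv _ _).symm_apply_apply _)

variable {adj} in
lemma adjunctCochain_bijective (V : CochainComplex C₂ ℤ) (J : CochainComplex C₁ ℤ) (n : ℤ) :
    Function.Bijective fun z : Cochain V ((onComplexes G).obj J) n =>
      (Cochain.map z F).comp (Cochain.ofHom (counitOnComplexes adj J)) (add_zero n) := by
  constructor
  · intro z₁ z₂ h
    ext p q hpq
    apply (adj.homEquiv _ _).symm.injective
    simpa [counitOnComplexes] using! Cochain.congr_v h p q hpq
  · intro z
    refine ⟨Cochain.mk fun p q hpq => adj.homEquiv _ _ (z.v p q hpq), ?_⟩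
    ext p q hpq
    simpa [counitOnComplexes] using! (adj.homEquiv _ _).symm_apply_apply (z.v p q hpq)

lemma δ_map_comp_counit {V : CochainComplex C₂ ℤ} {J : CochainComplex C₁ ℤ} {n : ℤ}
    (z : Cochain V ((onComplexes G).obj J) n) (m : ℤ) :
    δ n m ((Cochain.map z F).comp (Cochain.ofHom (counitOnComplexes adj J)) (add_zero n)) =
      (Cochain.map (δ n m z) F).comp (Cochain.ofHom (counitOnComplexes adj J)) (add_zero m) := by
  rw [δ_comp_ofHom, δ_map]

lemma isIso_homComplexMap_comp_counit (V : CochainComplex C₂ ℤ) (J : CochainComplex C₁ ℤ) :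
    IsIso (homComplexMap F V ((onComplexes G).obj J) ≫
      homComplexPostcomp ((onComplexes F).obj V) (counitOnComplexes adj J)) := by
  have (n : ℤ) : IsIso ((homComplexMap F V ((onComplexes G).obj J) ≫
      homComplexPostcomp ((onComplexes F).obj V) (counitOnComplexes adj J)).f n) := by
    rw [ConcreteCategory.isIso_iff_bijective]
    exact adjunctCochain_bijective (adj := adj) V J n
  exact HomologicalComplex.Hom.isIso_of_components _

lemma homComplexMap_comp_homComplexPostcomp {V K L : CochainComplex C₂ ℤ} (ψ : K ⟶ L) :
    homComplexPostcomp V ψ ≫ homComplexMap F V L = homComplexMap F V K ≫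
      homComplexPostcomp ((onComplexes F).obj V) ((onComplexes F).map ψ) := by
  ext n z
  have (z : Cochain V K n) : Cochain.map (z.comp (Cochain.ofHom ψ) (add_zero n)) F =
      (Cochain.map z F).comp (Cochain.ofHom ((onComplexes F).map ψ)) (add_zero n) := by
    rw [Cochain.map_comp, Cochain.map_ofHom]
  exact this z

-- The exact left adjoint `F` preserves acyclic complexes, and null-homotopies pass through the
-- adjunction on cochains.
include adj in
lemma isKInjective_rightAdjoint [PreservesFiniteLimits F] [PreservesFiniteColimits F]
    (J : CochainComplex C₁ ℤ) [J.IsKInjective] :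
    ((onComplexes G).obj J).IsKInjective where
  nonempty_homotopy_zero {Z} f hZ := by
    have hFZ : ((onComplexes F).obj Z).Acyclic := fun i =>
      ShortComplex.Exact.map (hZ i) F
    obtain ⟨H⟩ := IsKInjective.nonempty_homotopy_zero
      ((onComplexes F).map f ≫ counitOnComplexes adj J) hFZ
    obtain ⟨α, hα⟩ := Cochain.equivHomotopy _ _ H
    obtain ⟨β, rfl⟩ := (adjunctCochain_bijective (adj := adj) Z J (-1)).2 α
    refine ⟨(Cochain.equivHomotopy _ _).symm ⟨β,
      (adjunctCochain_bijective (adj := adj) Z J 0).1 ?_⟩⟩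
    rw [Cochain.ofHom_zero, add_zero] at hα ⊢
    dsimp only at hα ⊢
    rw [← δ_map_comp_counit, ← hα, Cochain.map_ofHom, Cochain.ofHom_comp]

lemma isIso_comparison [HasDerivedCategory.{w} AddCommGrpCat.{v}]
    [PreservesFiniteLimits F] [PreservesFiniteColimits F]
    (V : CochainComplex C₂ ℤ) {W : CochainComplex C₂ ℤ} (I : KInjectiveResolution W)
    (J : KInjectiveResolution ((onComplexes F).obj W))
    (φ : (onComplexes F).obj I.complex ⟶ J.complex) (hφ : QuasiIso (adjunct adj φ)) :
    IsIso (comparison V I J φ) := by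
  have := I.isKInjective
  have := J.isKInjective
  have := isKInjective_rightAdjoint adj J.complex
  obtain ⟨e, he⟩ := (IsKInjective.quasiIso_iff _).1 hφ
  have := isIso_homComplexMap_comp_counit adj V J.complex
  have := isIso_Q_map_homComplexPostcomp V e
  have fac : homComplexMap F V I.complex ≫ homComplexPostcomp ((onComplexes F).obj V) φ =
      homComplexPostcomp V e.hom ≫ (homComplexMap F V ((onComplexes G).obj J.complex) ≫
        homComplexPostcomp ((onComplexes F).obj V) (counitOnComplexes adj J.complex)) := by
    rw [he, ← Category.assoc, homComplexMap_comp_homComplexPostcomp, Category.assoc,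
      ← homComplexPostcomp_comp, map_adjunct_comp_counit]
  unfold comparison
  rw [fac, Functor.map_comp]
  exact IsIso.comp_isIso' this (Functor.map_isIso DerivedCategory.Q _)

end Adjunction

/-! ### Morphisms in the homotopy and derived categories -/

section Lifts

variable {C : Type u} [Category.{v} C] [Abelian C]

-- Homotopy classes of maps into a K-injective complex are morphisms of the derived category, where
-- `f` is invertible.
attribute [local instance] HasDerivedCategory.standard in
lemma precomp_bijective_of_isKInjective {K L : CochainComplex C ℤ} (f : K ⟶ L) [QuasiIso f]
    (J : CochainComplex C ℤ) [J.IsKInjective] :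
    Function.Bijective fun g : (HomotopyCategory.quotient C (.up ℤ)).obj L ⟶
      (HomotopyCategory.quotient C (.up ℤ)).obj J =>
        (HomotopyCategory.quotient C (.up ℤ)).map f ≫ g := by
  have hf : IsIso (DerivedCategory.Qh.map ((HomotopyCategory.quotient C (.up ℤ)).map f)) :=
    inferInstanceAs (IsIso (DerivedCategory.Q.map f))
  rw [← Function.Bijective.of_comp_iff' (IsKInjective.Qh_map_bijective _ J)]
  convert ((asIso (DerivedCategory.Qh.map
    ((HomotopyCategory.quotient C (.up ℤ)).map f))).symm.homFromEquiv.bijective).comp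
      (IsKInjective.Qh_map_bijective _ J)
  ext g
  simp

attribute [local instance] HasDerivedCategory.standard in
lemma postcomp_bijective_of_isKProjective {K L : CochainComplex C ℤ} (f : K ⟶ L) [QuasiIso f]
    (P : CochainComplex C ℤ) [P.IsKProjective] :
    Function.Bijective fun g : (HomotopyCategory.quotient C (.up ℤ)).obj P ⟶
      (HomotopyCategory.quotient C (.up ℤ)).obj K =>
        g ≫ (HomotopyCategory.quotient C (.up ℤ)).map f := by
  have hf : IsIso (DerivedCategory.Qh.map ((HomotopyCategory.quotient C (.up ℤ)).map f)) :=
    inferInstanceAs (IsIso (DerivedCategory.Q.map f))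
  rw [← Function.Bijective.of_comp_iff' (IsKProjective.Qh_map_bijective P _)]
  convert ((asIso (DerivedCategory.Qh.map
    ((HomotopyCategory.quotient C (.up ℤ)).map f))).homToEquiv.bijective).comp
      (IsKProjective.Qh_map_bijective P _)
  ext g
  simp

end Lifts

/-! ### Cohomology of Hom complexes as homotopy classes -/

section CohomologyClasses

variable {C : Type u} [Category.{v} C] [Abelian C]

/-- Postcomposition with `φ` induces bijections on the cohomology of the complexes of morphisms
from `S`, expressed in terms of cocycles. -/
structure PostcompBijective (S : CochainComplex C ℤ) {K L : CochainComplex C ℤ} (φ : K ⟶ L) :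
    Prop where
  injective : ∀ (n : ℤ) (x : Cocycle S K n),
    x.postcomp φ ∈ coboundaries S L n → x ∈ coboundaries S K n
  surjective : ∀ (n : ℤ) (y : Cocycle S L n),
    ∃ x : Cocycle S K n, y - x.postcomp φ ∈ coboundaries S L n

lemma toHom_mk_postcomp {S K L : CochainComplex C ℤ} (φ : K ⟶ L) {n : ℤ} (x : Cocycle S K n) :
    CohomologyClass.toHom (.mk (x.postcomp φ)) = CohomologyClass.toHom (.mk x) ≫
      (HomotopyCategory.quotient C (.up ℤ)).map (φ⟦n⟧') := by
  rw [CohomologyClass.toHom_mk, CohomologyClass.toHom_mk, ← Functor.map_comp]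
  congr 1
  ext p
  simp [Cocycle.equivHomShift, Cochain.rightShift_v _ n 0 (zero_add n) p p _ (p + n)]
  exact (Category.comp_id _).trans (congr_arg (· ≫ φ.f _) (Category.comp_id _).symm)

lemma toHom_mk_precomp {S T K : CochainComplex C ℤ} (p : S ⟶ T) {n : ℤ} (x : Cocycle T K n) :
    CohomologyClass.toHom (.mk (x.precomp p)) = (HomotopyCategory.quotient C (.up ℤ)).map p ≫
      CohomologyClass.toHom (.mk x) := by
  rw [CohomologyClass.toHom_mk, CohomologyClass.toHom_mk, ← Functor.map_comp]
  congr 1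
  ext q
  simp [Cocycle.equivHomShift, Cochain.rightShift_v _ n 0 (zero_add n) q q _ (q + n)]
  exact (Category.comp_id _).trans (congr_arg (p.f _ ≫ ·) (Category.comp_id _).symm)

lemma postcompBijective_of_homotopyCategory {S K L : CochainComplex C ℤ} (φ : K ⟶ L)
    (h : ∀ n : ℤ, Function.Bijective fun g : (HomotopyCategory.quotient C (.up ℤ)).obj S ⟶
      (HomotopyCategory.quotient C (.up ℤ)).obj (K⟦n⟧) =>
        g ≫ (HomotopyCategory.quotient C (.up ℤ)).map (φ⟦n⟧')) :
    PostcompBijective S φ where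
  injective n x hx := by
    rw [← CohomologyClass.toHom_mk_eq_zero_iff] at hx ⊢
    apply (h n).1
    dsimp only
    rw [← toHom_mk_postcomp, hx, zero_comp]
  surjective n y := by
    obtain ⟨g, hg⟩ := (h n).2 (CohomologyClass.toHom (.mk y))
    obtain ⟨x, rfl⟩ := (CohomologyClass.toHom_bijective _ _ _).2 g
    obtain ⟨x, rfl⟩ := x.mk_surjective
    refine ⟨x, ?_⟩
    rw [← CohomologyClass.toHom_mk_eq_zero_iff, CohomologyClass.mk_sub, map_sub,
      toHom_mk_postcomp, ← hg, sub_self]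

lemma precomp_bijective_of_cochains {S T K : CochainComplex C ℤ} (p : S ⟶ T)
    (h : ∀ n : ℤ, Function.Bijective fun z : Cochain T K n =>
      (Cochain.ofHom p).comp z (zero_add n)) (n : ℤ) :
    Function.Bijective fun g : (HomotopyCategory.quotient C (.up ℤ)).obj T ⟶
      (HomotopyCategory.quotient C (.up ℤ)).obj (K⟦n⟧) =>
        (HomotopyCategory.quotient C (.up ℤ)).map p ≫ g := by
  constructor
  · intro g₁ g₂ hg
    rw [← sub_eq_zero]
    obtain ⟨x, hx⟩ := (CohomologyClass.toHom_bijective _ _ _).2 (g₁ - g₂)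
    obtain ⟨x, rfl⟩ := x.mk_surjective
    have : CohomologyClass.toHom (.mk (x.precomp p)) = 0 := by
      rw [toHom_mk_precomp, hx, Preadditive.comp_sub, sub_eq_zero]
      exact hg
    rw [CohomologyClass.toHom_mk_eq_zero_iff, mem_coboundaries_iff _ (n - 1) (by lia)] at this
    obtain ⟨β, hβ⟩ := this
    obtain ⟨γ, rfl⟩ := (h (n - 1)).2 β
    rw [← hx, CohomologyClass.toHom_mk_eq_zero_iff, mem_coboundaries_iff _ (n - 1) (by lia)]
    refine ⟨γ, (h n).1 ?_⟩
    dsimp only at hβ ⊢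
    rw [← δ_ofHom_comp, hβ]
    rfl
  · intro g
    obtain ⟨x, rfl⟩ := (CohomologyClass.toHom_bijective _ _ _).2 g
    obtain ⟨x, rfl⟩ := x.mk_surjective
    obtain ⟨y, hy⟩ := (h n).2 x.1
    refine ⟨CohomologyClass.toHom (.mk (Cocycle.mk y (n + 1) rfl ((h (n + 1)).1 ?_))), ?_⟩
    · dsimp only at hy ⊢
      rw [← δ_ofHom_comp, hy, Cocycle.δ_eq_zero, Cochain.comp_zero]
    · dsimp only
      rw [← toHom_mk_precomp]
      congr 2
      ext1
      exact hy

/-- In the square of precompositions with `p` and postcompositions with `φ`, three sides are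
bijective: by `h`, by K-projectivity of `P`, and by K-injectivity of `J`. So is the fourth. -/
lemma postcompBijective_of_isKProjective_of_isKInjective {P S K J : CochainComplex C ℤ}
    [P.IsKProjective] [J.IsKInjective] (p : P ⟶ S) [QuasiIso p] (φ : K ⟶ J) [QuasiIso φ]
    (h : ∀ n : ℤ, Function.Bijective fun z : Cochain S K n =>
      (Cochain.ofHom p).comp z (zero_add n)) :
    PostcompBijective S φ := by
  refine postcompBijective_of_homotopyCategory φ fun n => ?_
  have : QuasiIso (φ⟦n⟧') := inferInstance
  rw [← Function.Bijective.of_comp_iff' (precomp_bijective_of_isKInjective p (J⟦n⟧))]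
  convert (postcomp_bijective_of_isKProjective (φ⟦n⟧') P).comp
    (precomp_bijective_of_cochains p h n) using 1
  ext g
  simp

end CohomologyClasses

/-! ### Passage from `φ` to its adjunct -/

section Transposition

variable {C₁ : Type u₁} [Category.{v} C₁] [Abelian C₁]
  {C₂ : Type u₂} [Category.{v} C₂] [Abelian C₂]
  {F : C₂ ⥤ C₁} [F.Additive] {G : C₁ ⥤ C₂} [G.Additive] (adj : F ⊣ G)

variable (F) in
lemma cochainMap_bijective [F.Full] [F.Faithful] (V K : CochainComplex C₂ ℤ) (n : ℤ) :
    Function.Bijective fun z : Cochain V K n => Cochain.map z F := by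
  constructor
  · intro z₁ z₂ h
    ext p q hpq
    exact F.map_injective (Cochain.congr_v h p q hpq)
  · intro z
    exact ⟨Cochain.mk fun p q hpq => F.preimage (z.v p q hpq), by
      ext p q hpq; exact F.map_preimage _⟩

lemma map_comp_adjunct_comp_counit {S K : CochainComplex C₂ ℤ} {J : CochainComplex C₁ ℤ}
    (φ : (onComplexes F).obj K ⟶ J) {n : ℤ} (z : Cochain S K n) :
    (Cochain.map (z.comp (Cochain.ofHom (adjunct adj φ)) (add_zero n)) F).comp
      (Cochain.ofHom (counitOnComplexes adj J)) (add_zero n) =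
    (Cochain.map z F).comp (Cochain.ofHom φ) (add_zero n) := by
  rw [Cochain.map_comp, Cochain.map_ofHom, Cochain.comp_assoc_of_second_is_zero_cochain,
    ← Cochain.ofHom_comp, map_adjunct_comp_counit]

/-- Full faithfulness identifies `Hom(S, K)` with `Hom(F S, F K)`, the adjunction identifies `Hom(S,
G J)` with `Hom(F S, J)`, and postcomposition with the adjunct corresponds to postcomposition with
`φ`. -/
lemma PostcompBijective.adjunct [F.Full] [F.Faithful] {S K : CochainComplex C₂ ℤ}
    {J : CochainComplex C₁ ℤ} {φ : (onComplexes F).obj K ⟶ J}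
    (h : PostcompBijective ((onComplexes F).obj S) φ) :
    PostcompBijective S (adjunct adj φ) where
  injective n x hx := by
    rw [mem_coboundaries_iff _ (n - 1) (by lia)] at hx ⊢
    obtain ⟨y, hy⟩ := hx
    have := h.injective n (Cocycle.mk (Cochain.map x.1 F) (n + 1) rfl (by
      rw [δ_map, Cocycle.δ_eq_zero, Cochain.map_zero])) (by
        rw [mem_coboundaries_iff _ (n - 1) (by lia)]
        refine ⟨_, (δ_map_comp_counit adj y n).trans ?_⟩
        rw [hy]
        exact map_comp_adjunct_comp_counit adj φ x.1)
    rw [mem_coboundaries_iff _ (n - 1) (by lia)] at this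
    obtain ⟨z, hz⟩ := this
    obtain ⟨z, rfl⟩ := (cochainMap_bijective F S K (n - 1)).2 z
    exact ⟨z, (cochainMap_bijective F S K n).1 ((δ_map _ _ _ _).symm.trans hz)⟩
  surjective n y := by
    obtain ⟨x, hx⟩ := h.surjective n (Cocycle.mk ((Cochain.map y.1 F).comp
      (Cochain.ofHom (counitOnComplexes adj J)) (add_zero n)) (n + 1) rfl (by
        rw [δ_map_comp_counit, Cocycle.δ_eq_zero, Cochain.map_zero, Cochain.zero_comp]))
    rw [mem_coboundaries_iff _ (n - 1) (by lia)] at hx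
    obtain ⟨z, hz⟩ := hx
    obtain ⟨x', hx'⟩ := (cochainMap_bijective F S K n).2 x.1
    obtain ⟨z', rfl⟩ := (adjunctCochain_bijective (adj := adj) S J (n - 1)).2 z
    refine ⟨Cocycle.mk x' (n + 1) rfl ((cochainMap_bijective F S K _).1 ?_), ?_⟩
    · dsimp only at hx' ⊢
      rw [← δ_map, hx', Cocycle.δ_eq_zero, Cochain.map_zero]
    · rw [mem_coboundaries_iff _ (n - 1) (by lia)]
      refine ⟨z', (adjunctCochain_bijective (adj := adj) S J n).1 ?_⟩
      dsimp only at hz hx' ⊢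
      rw [← δ_map_comp_counit, hz]
      have := map_comp_adjunct_comp_counit adj φ x'
      rw [hx'] at this
      change _ - x.1.comp (Cochain.ofHom φ) (add_zero n) =
        (Cochain.map (y.1 - x'.comp _ (add_zero n)) F).comp _ _
      rw [Cochain.map_sub, Cochain.sub_comp, this]
      rfl

end Transposition

/-! ### Detection of quasi-isomorphisms by the free module of rank one -/

section FreeModule

variable {R : Type u} [Ring R]

/-- Maps from `R` are elements, so cocycles and coboundaries from `R` in degree zero are those of
the complex itself. -/
lemma PostcompBijective.quasiIso {K L : CochainComplex (ModuleCat.{u} R) ℤ} {φ : K ⟶ L}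
    (h : PostcompBijective ((singleFunctor (ModuleCat.{u} R) 0).obj (ModuleCat.of R R)) φ) :
    QuasiIso φ := by
  let e {M : ModuleCat.{u} R} (x : M) : ModuleCat.of R R ⟶ M :=
    ModuleCat.ofHom (LinearMap.toSpanSingleton R M x)
  have he {M : ModuleCat.{u} R} (x : M) : e x (1 : R) = x := one_smul R x
  have he_comp {M N : ModuleCat.{u} R} (x : M) (g : M ⟶ N) : e x ≫ g = e (g x) := by
    ext
    simp [e]
  have he_zero {M : ModuleCat.{u} R} : e (0 : M) = 0 := by
    ext
    simp [e]
  refine quasiIso_of_forall_elements φ ?_ ?_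
  · intro i j k hij hjk x hx y hy
    have := h.injective j (Cocycle.fromSingleMk (e x) (zero_add j) k hjk
      (by rw [he_comp, hx, he_zero])) (by
        rw [← Cocycle.fromSingleMk_postcomp,
          Cocycle.fromSingleMk_mem_coboundaries_iff _ _ _ _ _ i hij]
        exact ⟨e y, by rw [he_comp, he_comp, hy]⟩)
    rw [Cocycle.fromSingleMk_mem_coboundaries_iff _ _ _ _ _ i hij] at this
    obtain ⟨g, hg⟩ := this
    exact ⟨g (1 : R), (ConcreteCategory.congr_hom hg (1 : R)).trans (he x)⟩
  · intro i j k hij hjk y hy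
    obtain ⟨x, hx⟩ := h.surjective j (Cocycle.fromSingleMk (e y) (zero_add j) k hjk
      (by rw [he_comp, hy, he_zero]))
    obtain ⟨x, hx', rfl⟩ := Cocycle.fromSingleMk_surjective x j (zero_add j) k hjk
    rw [← Cocycle.fromSingleMk_postcomp, ← Cocycle.fromSingleMk_sub,
      Cocycle.fromSingleMk_mem_coboundaries_iff _ _ _ _ _ i hij] at hx
    obtain ⟨z, hz⟩ := hx
    refine ⟨x (1 : R), z (1 : R), ConcreteCategory.congr_hom hx' (1 : R), ?_⟩
    have := ConcreteCategory.congr_hom hz (1 : R)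
    exact (congr_arg _ this).trans ((add_sub_cancel _ _).trans (he y))

end FreeModule

/-! ### The vanishing hypothesis on the resolution -/

section ProjectiveResolutions

variable {C : Type u} [Category.{v} C] [Abelian C]

/-- Only degree `0` contributes. There a map `P_0 ⟶ K.X q` kills the image of `P_1`, because maps
from `P_1` vanish, and so factors uniquely through the cokernel `X`. -/
lemma precomp_π'_bijective {X : C} (P : ProjectiveResolution X) (K : CochainComplex C ℤ)
    (h : ∀ (q : ℤ) (j : ℕ), 0 < j → ∀ f : P.complex.X j ⟶ K.X q, f = 0) (n : ℤ) :
    Function.Bijective fun z : Cochain ((singleFunctor C 0).obj X) K n =>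
      (Cochain.ofHom P.π').comp z (zero_add n) := by
  have hX (i : ℤ) (hi : i ≠ 0) : IsZero (((singleFunctor C 0).obj X).X i) :=
    HomologicalComplex.isZero_single_obj_X _ _ _ _ hi
  have hP (i : ℤ) (hi : i ≠ 0) (q : ℤ) (f : P.cochainComplex.X i ⟶ K.X q) : f = 0 := by
    by_cases hi' : i ≤ 0
    · obtain ⟨k, rfl⟩ := Int.exists_eq_neg_ofNat hi'
      rw [← cancel_epi (P.cochainComplexXIso (-k) k).inv, comp_zero]
      exact h q k (by lia) _
    · exact (P.cochainComplex.isZero_of_isStrictlyLE 0 i (by lia)).eq_of_src _ _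
  let a : P.cochainComplex.X 0 ≅ P.complex.X 0 := P.cochainComplexXIso 0 0
  let b : ((singleFunctor C 0).obj X).X 0 ≅ X := HomologicalComplex.singleObjXSelf (.up ℤ) 0 X
  let ε : P.complex.X 0 ⟶ X := P.π.f 0
  have hε : P.π'.f 0 = a.hom ≫ ε ≫ b.inv := P.π'_f_zero
  have : Epi ε := inferInstanceAs (Epi (P.π.f 0))
  have hdesc {q : ℤ} (f : P.complex.X 0 ⟶ K.X q) : ∃ y : X ⟶ K.X q, ε ≫ y = f :=
    ⟨P.exact₀.desc f (h q 1 one_pos _), P.exact₀.g_desc f (h q 1 one_pos _)⟩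
  have hepi : Epi (P.π'.f 0) := by
    rw [hε]
    infer_instance
  constructor
  · intro z₁ z₂ hz
    ext i q hiq
    by_cases hi : i = 0
    · subst hi
      have := Cochain.congr_v hz 0 q hiq
      simpa [cancel_epi] using this
    · exact (hX i hi).eq_of_src _ _
  · intro z
    have key (i q : ℤ) (hiq : i + n = q) : ∃ y : ((singleFunctor C 0).obj X).X i ⟶ K.X q,
        P.π'.f i ≫ y = z.v i q hiq := by
      by_cases hi : i = 0
      · subst hi
        obtain ⟨y, hy⟩ := hdesc (a.inv ≫ z.v 0 q hiq)
        exact ⟨b.hom ≫ y, by simp [hε, hy]⟩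
      · exact ⟨0, (hP i hi q _).trans (hP i hi q _).symm⟩
    choose y hy using key
    refine ⟨Cochain.mk y, ?_⟩
    ext i q hiq
    simp [hy]

lemma precomp_iso_bijective {S T : CochainComplex C ℤ} (e : S ≅ T) (K : CochainComplex C ℤ)
    (n : ℤ) : Function.Bijective fun z : Cochain T K n =>
      (Cochain.ofHom e.hom).comp z (zero_add n) := by
  refine Function.bijective_iff_has_inverse.2
    ⟨fun z => (Cochain.ofHom e.inv).comp z (zero_add n), fun z => ?_, fun z => ?_⟩
  all_goals
    dsimp only
    rw [← Cochain.comp_assoc_of_first_is_zero_cochain, ← Cochain.ofHom_comp]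
    simp

end ProjectiveResolutions

/-! ### Existence and uniqueness of lifts; reduction to the adjunct -/

section Uniqueness

variable {C₁ : Type u₁} [Category.{v} C₁] [Abelian C₁]
  {C₂ : Type u₂} [Category.{v} C₂] [Abelian C₂]
  {F : C₂ ⥤ C₁} [F.Additive] {W : CochainComplex C₂ ℤ} (I : KInjectiveResolution W)
  (J : KInjectiveResolution ((onComplexes F).obj W))

lemma quasiIso_map_ι [PreservesFiniteLimits F] [PreservesFiniteColimits F] :
    QuasiIso ((onComplexes F).map I.ι) := by
  have := I.quasiIso
  infer_instance

lemma exists_liftsIdentity [PreservesFiniteLimits F] [PreservesFiniteColimits F] :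
    ∃ φ : (onComplexes F).obj I.complex ⟶ J.complex, LiftsIdentity I J φ := by
  have := quasiIso_map_ι (F := F) I
  have := J.isKInjective
  obtain ⟨g, hg⟩ := (precomp_bijective_of_isKInjective ((onComplexes F).map I.ι) J.complex).2
    ((HomotopyCategory.quotient _ _).map J.ι)
  obtain ⟨φ, rfl⟩ := (HomotopyCategory.quotient _ _).map_surjective g
  exact ⟨φ, ⟨HomotopyCategory.homotopyOfEq _ _ (by rw [Functor.map_comp]; exact hg)⟩⟩

variable {I J}

lemma LiftsIdentity.homotopy [PreservesFiniteLimits F] [PreservesFiniteColimits F]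
    {φ ψ : (onComplexes F).obj I.complex ⟶ J.complex} (hφ : LiftsIdentity I J φ)
    (hψ : LiftsIdentity I J ψ) : Nonempty (Homotopy φ ψ) := by
  have := quasiIso_map_ι (F := F) I
  have := J.isKInjective
  obtain ⟨H⟩ := hφ
  obtain ⟨H'⟩ := hψ
  refine ⟨HomotopyCategory.homotopyOfEq _ _
    ((precomp_bijective_of_isKInjective ((onComplexes F).map I.ι) J.complex).1 ?_)⟩
  dsimp only
  rw [← Functor.map_comp, ← Functor.map_comp]
  exact HomotopyCategory.eq_of_homotopy _ _ (H.trans H'.symm)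

lemma LiftsIdentity.quasiIso [PreservesFiniteLimits F] [PreservesFiniteColimits F]
    {φ : (onComplexes F).obj I.complex ⟶ J.complex} (hφ : LiftsIdentity I J φ) : QuasiIso φ := by
  have := quasiIso_map_ι (F := F) I
  have := J.quasiIso
  obtain ⟨H⟩ := hφ
  have : QuasiIso ((onComplexes F).map I.ι ≫ φ) := by
    rw [quasiIso_iff]
    intro i
    rw [quasiIsoAt_iff_isIso_homologyMap, H.homologyMap_eq]
    infer_instance
  exact quasiIso_of_comp_left ((onComplexes F).map I.ι) φ

lemma LiftsIdentity.comparison_eq [HasDerivedCategory.{w} AddCommGrpCat.{v}]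
    [PreservesFiniteLimits F] [PreservesFiniteColimits F] (V : CochainComplex C₂ ℤ)
    {φ ψ : (onComplexes F).obj I.complex ⟶ J.complex} (hφ : LiftsIdentity I J φ)
    (hψ : LiftsIdentity I J ψ) : comparison V I J φ = comparison V I J ψ := by
  obtain ⟨H⟩ := hφ.homotopy hψ
  unfold comparison
  rw [Functor.map_comp, Functor.map_comp,
    DerivedCategory.Q_map_eq_of_homotopy _ (homComplexPostcompHomotopy _ H)]

lemma conditionR_of_quasiIso_adjunct [HasDerivedCategory.{w} AddCommGrpCat.{v}]
    [PreservesFiniteLimits F] [PreservesFiniteColimits F]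
    {G : C₁ ⥤ C₂} [G.Additive] (adj : F ⊣ G) (h₁ : EnoughKInjectives C₁)
    (h₂ : EnoughKInjectives C₂)
    (h : ∀ (K : CochainComplex C₂ ℤ) (J : CochainComplex C₁ ℤ) [J.IsKInjective]
      (φ : (onComplexes F).obj K ⟶ J), QuasiIso φ → QuasiIso (adjunct adj φ)) :
    ConditionR.{w} F := by
  refine ⟨h₁, h₂, fun V W I J => ⟨exists_liftsIdentity I J, ?_⟩⟩
  obtain ⟨φ, hφ⟩ := exists_liftsIdentity I J
  have := J.isKInjective
  have := isIso_comparison adj V I J φ (h _ _ φ hφ.quasiIso)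
  exact ⟨asIso (comparison V I J φ), fun ψ hψ => hψ.comparison_eq V hφ⟩

end Uniqueness

/-! ### Restriction and coextension of scalars -/

section RestrictionOfScalars

lemma full_restrictScalars_of_surjective {R : Type u₁} {S : Type u₂} [Ring R] [Ring S]
    (f : R →+* S) (hf : Function.Surjective f) :
    (ModuleCat.restrictScalars.{v} f).Full where
  map_surjective {M N} g :=
    ⟨ModuleCat.ofHom
      { toFun := g
        map_add' := g.hom.map_add
        map_smul' := fun s x => by
          obtain ⟨r, rfl⟩ := hf s
          exact g.hom.map_smul r x }, rfl⟩

instance additive_coextendScalars {R : Type u₁} {S : Type u₂} [Ring R] [Ring S]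
    (f : R →+* S) : (ModuleCat.coextendScalars.{u₁, u₂, v} f).Additive where
  map_add {_ _ _ _} := rfl

end RestrictionOfScalars

end RHomComparison

open RHomComparison CochainComplex in
theorem corollary8 {A : Type u} [Ring A] (I : Ideal A) [I.IsTwoSided]
    [HasDerivedCategory.{w} AddCommGrpCat.{u}]
    (P : ProjectiveResolution (ModuleCat.of A (A ⧸ I)))
    (n : ℕ) (hfinite : ∀ j : ℕ, n < j → Limits.IsZero (P.complex.X j))
    (hHom : ∀ (V : ModuleCat.{u} (A ⧸ I)) (j : ℕ), 0 < j →
      ∀ f : P.complex.X j ⟶ (ModuleCat.restrictScalars (Ideal.Quotient.mk I)).obj V, f = 0) :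
    RHomComparison.ConditionR
      (ModuleCat.restrictScalars.{u} (Ideal.Quotient.mk I)) := by
  let F := ModuleCat.restrictScalars.{u} (Ideal.Quotient.mk I)
  have : F.Full := full_restrictScalars_of_surjective _ Ideal.Quotient.mk_surjective
  have : Limits.PreservesFiniteLimits F := ⟨fun J _ _ => ⟨fun {_} => inferInstance⟩⟩
  have : Limits.PreservesFiniteColimits F := ⟨fun J _ _ => ⟨fun {_} => inferInstance⟩⟩
  refine conditionR_of_quasiIso_adjunct
    (ModuleCat.restrictCoextendScalarsAdj (Ideal.Quotient.mk I))
    (enoughKInjectives_moduleCat _) (enoughKInjectives_moduleCat _) fun K J _ φ hφ => ?_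
  -- `S` is `B` in degree zero: over `B` it detects quasi-isomorphisms, and over `A` it is resolved
  -- by `P`.
  let S := (singleFunctor (ModuleCat.{u} (A ⧸ I)) 0).obj (ModuleCat.of _ (A ⧸ I))
  let e : (onComplexes F).obj S ≅
      (singleFunctor (ModuleCat.{u} A) 0).obj (ModuleCat.of A (A ⧸ I)) :=
    (HomologicalComplex.singleMapHomologicalComplex F (.up ℤ) 0).app (ModuleCat.of _ (A ⧸ I))
  refine PostcompBijective.quasiIso (PostcompBijective.adjunct _ (S := S) ?_)
  refine postcompBijective_of_isKProjective_of_isKInjective (P.π' ≫ e.inv) φ fun m => ?_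
  convert (precomp_π'_bijective P ((onComplexes F).obj K) (fun q => hHom (K.X q)) m).comp
    (precomp_iso_bijective e.symm ((onComplexes F).obj K) m) using 1
  ext1 z
  simp [HomComplex.Cochain.ofHom_comp]
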